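/- Consider the preemptive single-machine scheduling problem with objective total weighted completion time. An instance is a finite set of jobs $J_j$ with release dates $r_j\ge 0$, processing times $p_j>0$ and weights $w_j\ge 0$. The machine processes at most one job at a time, a job may be processed only from its release date on, and it may be interrupted and resumed later without any change of its total processing time. If $C_j$ denotes the completion time of $J_j$, the cost of a schedule is $\sum_j w_j C_j$. A deterministic online algorithm learns of the existence and the parameters of a job only at its release date. Its competitive ratio is the infimum of all $c$ such that, on every instance, its cost is at most $c$ times the optimal (offline) cost of that instance ($+\infty$ if there is no such $c$). Theorem. Every deterministic online algorithm for total weighted completion time scheduling with preemption on a single machine has competitive ratio at least $1.1038$. -/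

import Mathlib

open MeasureTheory

/-- A job with its release date, processing time and weight. -/
structure Job where
  release : ℝ
  proc : ℝ
  weight : ℝ
  release_nonneg : 0 ≤ release
  proc_pos : 0 < proc
  weight_nonneg : 0 ≤ weight

/-- A problem instance is a finite list of jobs, numbered in the order of their arrival;
jobs with the same release date may be listed in any order. -/
structure JobInstance where
  jobs : List Job
  sorted : jobs.Pairwise (fun a b => a.release ≤ b.release)

namespace JobInstance

/-- The jobs that have been released by time `t`. As the list is sorted by release date, they form
an initial segment of it, so that every job keeps its number. -/
noncomputable def known (I : JobInstance) (t : ℝ) : List Job :=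
  I.jobs.filter (fun j => j.release ≤ t)

end JobInstance

/-- The amount of processing that job number `i` has received up to time `t`, where `σ s` is the
number of the job that runs at time `s` (`none` if the machine is idle). -/
noncomputable def processed (σ : ℝ → Option ℕ) (i : ℕ) (t : ℝ) : ENNReal :=
  volume {s : ℝ | s ≤ t ∧ σ s = some i}

/-- `σ` is a feasible preemptive schedule of the instance `I` on a single machine: at every time at
most one job runs, and only after its release; a job may be interrupted and resumed at will; it is
processed for exactly its processing time and is completed at some finite time. -/
structure IsSchedule (I : JobInstance) (σ : ℝ → Option ℕ) : Prop where
  measurable : ∀ i : ℕ, MeasurableSet {s : ℝ | σ s = some i}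
  released : ∀ (s : ℝ) (i : ℕ), σ s = some i → ∃ h : i < I.jobs.length, (I.jobs[i]).release ≤ s
  total : ∀ (i : ℕ) (h : i < I.jobs.length),
    volume {s : ℝ | σ s = some i} = ENNReal.ofReal (I.jobs[i]).proc
  completes : ∀ (i : ℕ) (h : i < I.jobs.length),
    ∃ t : ℝ, processed σ i t = ENNReal.ofReal (I.jobs[i]).proc

/-- The completion time of job number `i`: the first time at which it has received its full
processing time. -/
noncomputable def completionTime (I : JobInstance) (σ : ℝ → Option ℕ)
    (i : Fin I.jobs.length) : ℝ :=
  sInf {t : ℝ | ENNReal.ofReal (I.jobs[i]).proc ≤ processed σ i t}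

/-- The total weighted completion time of a schedule. -/
noncomputable def totalWeightedCompletionTime (I : JobInstance) (σ : ℝ → Option ℕ) : ℝ :=
  ∑ i : Fin I.jobs.length, (I.jobs[i]).weight * completionTime I σ i

/-- The optimal (offline) total weighted completion time of an instance. -/
noncomputable def optimalCost (I : JobInstance) : ℝ :=
  sInf {c : ℝ | ∃ σ : ℝ → Option ℕ, IsSchedule I σ ∧ c = totalWeightedCompletionTime I σ}

/-- A deterministic online algorithm decides at every time `t` which job runs at time `t`, knowing
only `t` and the jobs released by time `t` (its earlier decisions are determined by these data).
On every instance the decisions must form a feasible schedule. -/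
structure OnlineAlgorithm where
  run : List Job → ℝ → Option ℕ
  feasible : ∀ I : JobInstance, IsSchedule I (fun t => run (I.known t) t)

namespace OnlineAlgorithm

/-- The schedule that the algorithm produces on the instance `I`. -/
noncomputable def schedule (A : OnlineAlgorithm) (I : JobInstance) : ℝ → Option ℕ :=
  fun t => A.run (I.known t) t

/-- The algorithm is `c`-competitive: on every instance its cost is at most `c` times the optimal
cost. -/
def IsCompetitive (A : OnlineAlgorithm) (c : ℝ) : Prop :=
  ∀ I : JobInstance, totalWeightedCompletionTime I (A.schedule I) ≤ c * optimalCost I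

/-- The competitive ratio: the infimum of all `c` for which the algorithm is `c`-competitive
(`⊤` if there is none). -/
noncomputable def competitiveRatio (A : OnlineAlgorithm) : EReal :=
  ⨅ (c : ℝ) (_ : A.IsCompetitive c), (c : EReal)

end OnlineAlgorithm

/-! An adversary argument. Two jobs of density (weight over length) 1 are available at time 0: a
long one of length 7/3 and a short one of length 1. An online algorithm must divide the machine
between them without knowing whether, and when, a flood of tiny dense jobs will arrive. A flood at
time 1 favours having completed the short job; a flood at time 7/3 favours having completed the long
one. By time 1 the short job has received at most 0.51 or at least 0.51, and the adversary sends the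
flood that suits the choice less.

The optimum is bounded above by an explicit nonpreemptive schedule (`optimalCost_flood_le`). The
algorithm is bounded below by Smith's rule applied to what remains when the flood arrives
(`IsSchedule.smith_le_sum`, `smith_flood_le`). The decision before the flood cannot depend on which
flood comes (`processed_schedule_flood_congr`), and the comparison of the two bounds is piecewise
linear in the remainders. -/

/-- The amount of processing that job number `i` has received up to time `t`, as a real number. -/
noncomputable def processedReal (σ : ℝ → Option ℕ) (i : ℕ) (t : ℝ) : ℝ :=
  (processed σ i t).toReal

/-! ### Machine capacity, completion times and the Smith lower bound -/

namespace IsSchedule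

variable {I : JobInstance} {σ : ℝ → Option ℕ}

lemma processed_le (h : IsSchedule I σ) (i : Fin I.jobs.length) (t : ℝ) :
    processed σ i t ≤ ENNReal.ofReal (I.jobs[i]).proc := by
  rw [Fin.getElem_fin, ← h.total i i.2]
  exact measure_mono fun s hs => hs.2

lemma processed_ne_top (h : IsSchedule I σ) (i : Fin I.jobs.length) (t : ℝ) :
    processed σ i t ≠ ⊤ :=
  ((h.processed_le i t).trans_lt ENNReal.ofReal_lt_top).ne

lemma processedReal_le (h : IsSchedule I σ) (i : Fin I.jobs.length) (t : ℝ) :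
    processedReal σ i t ≤ (I.jobs[i]).proc :=
  ENNReal.toReal_le_of_le_ofReal (I.jobs[i]).proc_pos.le (h.processed_le i t)

lemma processedReal_mono (h : IsSchedule I σ) (i : Fin I.jobs.length) :
    Monotone (processedReal σ i) := fun _ _ hst =>
  ENNReal.toReal_mono (h.processed_ne_top i _)
    (measure_mono fun _ hs => ⟨hs.1.trans hst, hs.2⟩)

lemma processed_eq_zero (h : IsSchedule I σ) (i : Fin I.jobs.length) {t : ℝ}
    (ht : t ≤ (I.jobs[i]).release) : processed σ i t = 0 := by
  refine measure_mono_null (t := {t}) (fun s hs => ?_) (by simp)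
  obtain ⟨_, hr⟩ := h.released s i hs.2
  exact le_antisymm hs.1 (ht.trans hr)

lemma processedReal_eq_zero (h : IsSchedule I σ) (i : Fin I.jobs.length) {t : ℝ}
    (ht : t ≤ (I.jobs[i]).release) : processedReal σ i t = 0 := by
  simp [processedReal, h.processed_eq_zero i ht]

lemma processedReal_sub (h : IsSchedule I σ) (i : Fin I.jobs.length) {s t : ℝ} (hst : s ≤ t) :
    processedReal σ i t - processedReal σ i s
      = volume.real ({r | σ r = some (i : ℕ)} ∩ Set.Ioc s t) := by
  have hd : processed σ i t
      = processed σ i s + volume ({r | σ r = some (i : ℕ)} ∩ Set.Ioc s t) := by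
    unfold processed
    rw [← measure_union _ ((h.measurable i).inter measurableSet_Ioc)]
    · congr 1
      ext r
      simp only [Set.mem_ofPred_eq, Set.mem_union, Set.mem_inter_iff, Set.mem_Ioc]
      constructor
      · rintro ⟨h1, h2⟩
        rcases le_or_gt r s with h3 | h3
        · exact Or.inl ⟨h3, h2⟩
        · exact Or.inr ⟨h2, h3, h1⟩
      · rintro (⟨h1, h2⟩ | ⟨h1, h2, h3⟩)
        · exact ⟨h1.trans hst, h2⟩
        · exact ⟨h3, h1⟩
    · rw [Set.disjoint_left]
      rintro r ⟨h1, _⟩ ⟨_, h2, _⟩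
      exact absurd h1 (not_le.2 h2)
  have hfin : volume ({r | σ r = some (i : ℕ)} ∩ Set.Ioc s t) ≠ ⊤ := by
    have := h.processed_ne_top i t
    rw [hd] at this
    exact (ENNReal.add_ne_top.1 this).2
  unfold processedReal
  rw [hd, ENNReal.toReal_add (h.processed_ne_top i s) hfin, measureReal_def]
  ring

/-- The sets of times at which different jobs run are disjoint, so their traces on an interval have
total measure at most its length. Every capacity bound below rests on this. -/
lemma sum_processedReal_sub_le (h : IsSchedule I σ) {s t : ℝ} (hst : s ≤ t) :
    ∑ i : Fin I.jobs.length, (processedReal σ i t - processedReal σ i s) ≤ t - s := by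
  simp_rw [h.processedReal_sub _ hst]
  rw [← measureReal_iUnion_fintype (h' := fun i =>
    ((measure_mono Set.inter_subset_right).trans_lt measure_Ioc_lt_top).ne)]
  · calc _ ≤ volume.real (Set.Ioc s t) :=
          measureReal_mono (Set.iUnion_subset fun i => Set.inter_subset_right)
            measure_Ioc_lt_top.ne
      _ = t - s := by simp [hst]
  · intro i j hij
    rw [Function.onFun, Set.disjoint_left]
    rintro r ⟨h1, _⟩ ⟨h2, _⟩
    simp only [Set.mem_ofPred_eq] at h1 h2
    rw [h1] at h2
    exact hij (Fin.ext (Option.some_injective _ h2))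
  · exact fun i => (h.measurable i).inter measurableSet_Ioc

lemma processedReal_sub_le (h : IsSchedule I σ) (i : Fin I.jobs.length) {s t : ℝ} (hst : s ≤ t) :
    processedReal σ i t - processedReal σ i s ≤ t - s :=
  (Finset.single_le_sum (f := fun i : Fin I.jobs.length =>
    processedReal σ i t - processedReal σ i s)
    (fun j _ => sub_nonneg.2 (h.processedReal_mono j hst)) (Finset.mem_univ i)).trans
    (h.sum_processedReal_sub_le hst)

lemma proc_le_processed_iff (h : IsSchedule I σ) (i : Fin I.jobs.length) (t : ℝ) :
    ENNReal.ofReal (I.jobs[i]).proc ≤ processed σ i t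
      ↔ (I.jobs[i]).proc ≤ processedReal σ i t :=
  ENNReal.ofReal_le_iff_le_toReal (h.processed_ne_top i t)

lemma release_le_of_mem (h : IsSchedule I σ) (i : Fin I.jobs.length) {t : ℝ}
    (ht : ENNReal.ofReal (I.jobs[i]).proc ≤ processed σ i t) : (I.jobs[i]).release ≤ t := by
  by_contra! hlt
  rw [h.processed_eq_zero i hlt.le, nonpos_iff_eq_zero, ENNReal.ofReal_eq_zero] at ht
  exact absurd (I.jobs[i]).proc_pos (not_lt.2 ht)

lemma bddBelow_completion (h : IsSchedule I σ) (i : Fin I.jobs.length) :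
    BddBelow {t : ℝ | ENNReal.ofReal (I.jobs[i]).proc ≤ processed σ i t} :=
  ⟨_, fun _ ht => h.release_le_of_mem i ht⟩

lemma completionTime_le (h : IsSchedule I σ) (i : Fin I.jobs.length) {t : ℝ}
    (ht : ENNReal.ofReal (I.jobs[i]).proc ≤ processed σ i t) : completionTime I σ i ≤ t :=
  csInf_le (h.bddBelow_completion i) ht

lemma nonempty_completion (h : IsSchedule I σ) (i : Fin I.jobs.length) :
    {t : ℝ | ENNReal.ofReal (I.jobs[i]).proc ≤ processed σ i t}.Nonempty := by
  obtain ⟨t, ht⟩ := h.completes i i.2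
  exact ⟨t, ht.ge⟩

lemma release_le_completionTime (h : IsSchedule I σ) (i : Fin I.jobs.length) :
    (I.jobs[i]).release ≤ completionTime I σ i :=
  le_csInf (h.nonempty_completion i) fun _ ht => h.release_le_of_mem i ht

/-- A job has received its full processing time at its completion time. -/
lemma processedReal_completionTime (h : IsSchedule I σ) (i : Fin I.jobs.length) :
    processedReal σ i (completionTime I σ i) = (I.jobs[i]).proc := by
  -- The infimum is attained because the processed amount is 1-Lipschitz in time: the job is done at
  -- times arbitrarily close to the infimum.
  refine le_antisymm (h.processedReal_le i _) (le_of_forall_pos_le_add fun ε hε => ?_)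
  obtain ⟨t, ht, hlt⟩ := exists_lt_of_csInf_lt (h.nonempty_completion i)
    (show completionTime I σ i < completionTime I σ i + ε by linarith)
  have h1 := (h.proc_le_processed_iff i t).1 ht
  have h2 := h.processedReal_sub_le i (h.completionTime_le i ht)
  linarith

lemma processedReal_eq_proc (h : IsSchedule I σ) (i : Fin I.jobs.length) {t : ℝ}
    (ht : completionTime I σ i ≤ t) : processedReal σ i t = (I.jobs[i]).proc :=
  le_antisymm (h.processedReal_le i _)
    ((h.processedReal_completionTime i).ge.trans (h.processedReal_mono i ht))

lemma release_add_proc_le_completionTime (h : IsSchedule I σ) (i : Fin I.jobs.length) :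
    (I.jobs[i]).release + (I.jobs[i]).proc ≤ completionTime I σ i := by
  have h1 := h.processedReal_sub_le i (h.release_le_completionTime i)
  rw [h.processedReal_completionTime i, h.processedReal_eq_zero i le_rfl] at h1
  linarith

lemma totalWeightedCompletionTime_nonneg (h : IsSchedule I σ) :
    0 ≤ totalWeightedCompletionTime I σ :=
  Finset.sum_nonneg fun i _ => mul_nonneg (I.jobs[i]).weight_nonneg
    ((I.jobs[i]).release_nonneg.trans (h.release_le_completionTime i))

lemma optimalCost_le (h : IsSchedule I σ) : optimalCost I ≤ totalWeightedCompletionTime I σ :=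
  csInf_le ⟨0, by rintro _ ⟨τ, hτ, rfl⟩; exact hτ.totalWeightedCompletionTime_nonneg⟩ ⟨σ, h, rfl⟩

/-- The cost of the jobs that are unfinished at time `t` is at least the cost of processing their
remainders in the order of Smith's rule, which is a sum over pairs of jobs. -/
lemma smith_le_sum (h : IsSchedule I σ) (t : ℝ) (u x : Fin I.jobs.length → ℝ)
    (hu : ∀ i, 0 ≤ u i) (hx : ∀ i, x i = (I.jobs[i]).proc - processedReal σ i t)
    (hux : ∀ i, u i = 0 ∨ 0 < x i) :
    ∑ i, u i * (t + x i / 2) + (∑ i, ∑ j, min (u i * x j) (u j * x i)) / 2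
      ≤ ∑ i, u i * completionTime I σ i := by
  set C := completionTime I σ
  let D : Fin I.jobs.length → Fin I.jobs.length → ℝ :=
    fun i j => processedReal σ j (C i) - processedReal σ j t
  have hx0 : ∀ i, 0 ≤ x i := fun i => by rw [hx]; exact sub_nonneg.2 (h.processedReal_le i t)
  have hC : ∀ i, 0 < x i → t ≤ C i := by
    intro i hi
    by_contra! hlt
    rw [hx, h.processedReal_eq_proc i hlt.le] at hi
    linarith
  have hD : ∀ i j, 0 < x i → 0 ≤ D i j := fun i j hi =>
    sub_nonneg.2 (h.processedReal_mono j (hC i hi))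
  have huD : ∀ i j, 0 ≤ u i * D i j := by
    intro i j
    rcases hux i with h0 | hi
    · simp [h0]
    · exact mul_nonneg (hu i) (hD i j hi)
  have hDx : ∀ i j, C i ≤ C j → D j i = x i := by
    intro i j hij
    simp only [D, hx i, h.processedReal_eq_proc i hij]
  -- The time from `t` to `C i` covers all the work done in it; a job finished by `t` escapes this
  -- only through `u i = 0`.
  have hrow : ∀ i, u i * t + ∑ j, u i * D i j ≤ u i * C i := by
    intro i
    rcases hux i with h0 | hi
    · simp [h0]
    · rw [← Finset.mul_sum, ← mul_add]
      have := h.sum_processedReal_sub_le (hC i hi)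
      exact mul_le_mul_of_nonneg_left (by simp only [D]; linarith) (hu i)
  -- Of two jobs, the one that completes first has its whole remainder processed before the other
  -- completes. The diagonal term accounts for a job's own remainder.
  have hpair : ∀ i j, min (u i * x j) (u j * x i) + (if i = j then u i * x i else 0)
      ≤ u i * D i j + u j * D j i := by
    intro i j
    split_ifs with hij
    · subst hij
      rw [hDx i i le_rfl, min_self]
    · rcases le_total (C i) (C j) with hc | hc
      · have := huD i j
        rw [hDx i j hc]
        linarith [min_le_right (u i * x j) (u j * x i)]
      · have := huD j i
        rw [hDx j i hc]
        linarith [min_le_left (u i * x j) (u j * x i)]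
  have h1 := Finset.sum_le_sum fun i (_ : i ∈ Finset.univ) =>
    Finset.sum_le_sum fun j (_ : j ∈ Finset.univ) => hpair i j
  have h2 := Finset.sum_le_sum fun i (_ : i ∈ Finset.univ) => hrow i
  simp only [Finset.sum_add_distrib, Finset.sum_ite_eq, Finset.mem_univ, if_true] at h1 h2
  rw [Finset.sum_comm (f := fun i j => u j * D j i)] at h1
  have h3 : ∑ i, u i * (t + x i / 2) = ∑ i, u i * t + (∑ i, u i * x i) / 2 := by
    rw [Finset.sum_div, ← Finset.sum_add_distrib]
    exact Finset.sum_congr rfl fun i _ => by ring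
  rw [h3]
  linarith

end IsSchedule

/-! ### Nonpreemptive schedules as upper bounds for the optimum -/

/-- The schedule that processes job number `i` without interruption from time `start i` on. -/
noncomputable def blockSchedule (I : JobInstance) (start : ℕ → ℝ) (s : ℝ) : Option ℕ :=
  open Classical in
  if h : ∃ i : Fin I.jobs.length, s ∈ Set.Ico (start i) (start i + (I.jobs[i]).proc)
  then some h.choose else none

section BlockSchedule

variable {I : JobInstance} {start : ℕ → ℝ}

lemma blockSchedule_eq_some_iff
    (hd : ∀ i j : Fin I.jobs.length, i < j → start i + (I.jobs[i]).proc ≤ start j ∨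
      start j + (I.jobs[j]).proc ≤ start i) (i : Fin I.jobs.length) (s : ℝ) :
    blockSchedule I start s = some (i : ℕ) ↔
      s ∈ Set.Ico (start i) (start i + (I.jobs[i]).proc) := by
  unfold blockSchedule
  constructor
  · intro hs
    split_ifs at hs with h
    have := h.choose_spec
    rwa [Fin.ext (Option.some_injective _ hs)] at this
  · intro hs
    have h : ∃ i : Fin I.jobs.length, s ∈ Set.Ico (start i) (start i + (I.jobs[i]).proc) := ⟨i, hs⟩
    rw [dif_pos h]
    have hc := h.choose_spec
    obtain ⟨h1, h2⟩ := hs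
    obtain ⟨h3, h4⟩ := hc
    rcases lt_trichotomy h.choose i with hlt | heq | hlt
    · rcases hd _ _ hlt with h5 | h5 <;> linarith
    · rw [heq]
    · rcases hd _ _ hlt with h5 | h5 <;> linarith

lemma blockSchedule_lt_length {i : ℕ} {s : ℝ} (h : blockSchedule I start s = some i) :
    i < I.jobs.length := by
  unfold blockSchedule at h
  split_ifs at h with h'
  rw [← Option.some_injective _ h]
  exact h'.choose.2

lemma setOf_blockSchedule_eq
    (hd : ∀ i j : Fin I.jobs.length, i < j → start i + (I.jobs[i]).proc ≤ start j ∨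
      start j + (I.jobs[j]).proc ≤ start i) (i : Fin I.jobs.length) :
    {s | blockSchedule I start s = some (i : ℕ)}
      = Set.Ico (start i) (start i + (I.jobs[i]).proc) :=
  Set.ext fun s => blockSchedule_eq_some_iff hd i s

lemma processed_blockSchedule
    (hd : ∀ i j : Fin I.jobs.length, i < j → start i + (I.jobs[i]).proc ≤ start j ∨
      start j + (I.jobs[j]).proc ≤ start i) (i : Fin I.jobs.length) :
    processed (blockSchedule I start) i (start i + (I.jobs[i]).proc)
      = ENNReal.ofReal (I.jobs[i]).proc := by
  have : {s | s ≤ start i + (I.jobs[i]).proc ∧ blockSchedule I start s = some (i : ℕ)}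
      = Set.Ico (start i) (start i + (I.jobs[i]).proc) := by
    ext s
    rw [Set.mem_ofPred_eq, blockSchedule_eq_some_iff hd]
    exact ⟨fun h => h.2, fun h => ⟨h.2.le, h⟩⟩
  rw [processed, this, Real.volume_Ico, add_sub_cancel_left]

lemma isSchedule_blockSchedule
    (hd : ∀ i j : Fin I.jobs.length, i < j → start i + (I.jobs[i]).proc ≤ start j ∨
      start j + (I.jobs[j]).proc ≤ start i)
    (hr : ∀ i : Fin I.jobs.length, (I.jobs[i]).release ≤ start i) :
    IsSchedule I (blockSchedule I start) where
  measurable i := by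
    by_cases hi : i < I.jobs.length
    · exact (setOf_blockSchedule_eq hd ⟨i, hi⟩) ▸ measurableSet_Ico
    · have : {s | blockSchedule I start s = some i} = ∅ :=
        Set.eq_empty_of_forall_notMem fun s hs => hi (blockSchedule_lt_length hs)
      rw [this]
      exact MeasurableSet.empty
  released s i hs := by
    have hi := blockSchedule_lt_length hs
    exact ⟨hi, (hr ⟨i, hi⟩).trans ((blockSchedule_eq_some_iff hd ⟨i, hi⟩ s).1 hs).1⟩
  total i hi := by
    have := setOf_blockSchedule_eq hd ⟨i, hi⟩
    simp only [Fin.getElem_fin] at this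
    rw [this, Real.volume_Ico, add_sub_cancel_left]
  completes i hi := ⟨_, processed_blockSchedule hd ⟨i, hi⟩⟩

/-- The optimal cost is at most the cost of any nonpreemptive schedule. -/
lemma optimalCost_le_sum_start
    (hd : ∀ i j : Fin I.jobs.length, i < j → start i + (I.jobs[i]).proc ≤ start j ∨
      start j + (I.jobs[j]).proc ≤ start i)
    (hr : ∀ i : Fin I.jobs.length, (I.jobs[i]).release ≤ start i) :
    optimalCost I ≤ ∑ i : Fin I.jobs.length,
      (I.jobs[i]).weight * (start i + (I.jobs[i]).proc) := by
  have h := isSchedule_blockSchedule hd hr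
  refine h.optimalCost_le.trans (Finset.sum_le_sum fun i _ => ?_)
  exact mul_le_mul_of_nonneg_left
    (h.completionTime_le i (processed_blockSchedule hd i).ge) (I.jobs[i]).weight_nonneg

end BlockSchedule

/-! ### Floods: cost bounds for the optimum and for the algorithm -/

/-- Two jobs that are released at time `0`, followed by `n` copies of a third job. -/
def flood (A B F : Job) (hA : A.release = 0) (hB : B.release = 0) (n : ℕ) : JobInstance where
  jobs := A :: B :: List.replicate n F
  sorted := by
    have hF := F.release_nonneg
    simp only [List.pairwise_cons, List.mem_cons, List.mem_replicate, List.pairwise_replicate]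
    refine ⟨?_, ?_, Or.inr le_rfl⟩
    · rintro j (rfl | ⟨_, rfl⟩) <;> simp [hA, hB, hF]
    · rintro j ⟨_, rfl⟩
      simp [hB, hF]

section Flood

variable {A B F : Job} {hA : A.release = 0} {hB : B.release = 0} {n : ℕ}

lemma length_flood : (flood A B F hA hB n).jobs.length = n + 2 := by simp [flood]

lemma zero_lt_length_flood : 0 < (flood A B F hA hB n).jobs.length := by simp [flood]

lemma one_lt_length_flood : 1 < (flood A B F hA hB n).jobs.length := by simp [flood]

lemma add_two_lt_length_flood (k : Fin n) : k + 2 < (flood A B F hA hB n).jobs.length := by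
  simp [length_flood]

lemma sum_flood (f : Fin (flood A B F hA hB n).jobs.length → ℝ) :
    ∑ i, f i = f ⟨0, zero_lt_length_flood⟩ + (f ⟨1, one_lt_length_flood⟩
      + ∑ k : Fin n, f ⟨k + 2, add_two_lt_length_flood k⟩) := by
  rw [← (finCongr length_flood.symm).sum_comp, Fin.sum_univ_succ, Fin.sum_univ_succ]
  rfl

lemma flood_forall {p : Fin (flood A B F hA hB n).jobs.length → Prop}
    (h0 : p ⟨0, zero_lt_length_flood⟩) (h1 : p ⟨1, one_lt_length_flood⟩)
    (h2 : ∀ k : Fin n, p ⟨k + 2, add_two_lt_length_flood k⟩) (i) : p i := by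
  obtain ⟨i, hi⟩ := i
  match i with
  | 0 => exact h0
  | 1 => exact h1
  | k + 2 => exact h2 ⟨k, by simpa [flood] using hi⟩

lemma flood_getElem_zero (h : 0 < (flood A B F hA hB n).jobs.length) :
    (flood A B F hA hB n).jobs[0] = A := rfl

lemma flood_getElem_one (h : 1 < (flood A B F hA hB n).jobs.length) :
    (flood A B F hA hB n).jobs[1] = B := rfl

lemma flood_getElem_add_two (k : ℕ) (h : k + 2 < (flood A B F hA hB n).jobs.length) :
    (flood A B F hA hB n).jobs[k + 2] = F := by
  simp [flood]

lemma known_flood_of_lt {t : ℝ} (ht : t < F.release) :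
    (flood A B F hA hB n).known t = [A, B].filter (fun j => j.release ≤ t) := by
  simp [JobInstance.known, flood, List.filter_cons, ht]

lemma sum_mul_start_flood (w s p : ℝ) (n : ℕ) :
    ∑ k : Fin n, w * (s + (k : ℕ) * p + p) = n * w * s + w * p * n * (n + 1) / 2 := by
  rw [Fin.sum_univ_eq_sum_range (fun k : ℕ => w * (s + k * p + p))]
  induction n with
  | zero => simp
  | succ m ih =>
    rw [Finset.sum_range_succ, ih]
    push_cast
    ring

/-- The cost of processing the copies of `F` as a block from their release date on, and each of
the other two jobs before or after the block. -/
lemma optimalCost_flood_le {a b : ℝ} (ha : 0 ≤ a) (hb : 0 ≤ b)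
    (hab : a + A.proc ≤ b ∨ b + B.proc ≤ a)
    (haF : a + A.proc ≤ F.release ∨ F.release + n * F.proc ≤ a)
    (hbF : b + B.proc ≤ F.release ∨ F.release + n * F.proc ≤ b) :
    optimalCost (flood A B F hA hB n) ≤ A.weight * (a + A.proc) + B.weight * (b + B.proc)
      + (n * F.weight * F.release + F.weight * F.proc * n * (n + 1) / 2) := by
  let start : ℕ → ℝ := fun
    | 0 => a
    | 1 => b
    | k + 2 => F.release + k * F.proc
  have hF := F.proc_pos
  have hlast : ∀ k : Fin n, F.release + (k : ℕ) * F.proc + F.proc ≤ F.release + n * F.proc := by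
    intro k
    have : ((k : ℕ) : ℝ) + 1 ≤ n := by exact_mod_cast k.2
    nlinarith
  have hfirst : ∀ k : ℕ, F.release ≤ F.release + k * F.proc := fun k => by
    have : 0 ≤ (k : ℝ) * F.proc := by positivity
    linarith
  have key := optimalCost_le_sum_start (I := flood A B F hA hB n) (start := start) ?_ ?_
  · rw [sum_flood] at key
    simp only [Fin.getElem_fin, flood_getElem_zero, flood_getElem_one, flood_getElem_add_two,
      start] at key
    rw [sum_mul_start_flood] at key
    linarith
  · refine flood_forall ?_ ?_ fun k => ?_ <;>
      refine flood_forall ?_ ?_ fun l => ?_ <;> intro hlt <;>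
      simp only [Fin.mk_lt_mk] at hlt <;> try omega
    · exact hab
    · simp only [Fin.getElem_fin, flood_getElem_zero, flood_getElem_add_two, start]
      exact haF.imp (fun h => h.trans (hfirst _)) (fun h => (hlast l).trans h)
    · simp only [Fin.getElem_fin, flood_getElem_one, flood_getElem_add_two, start]
      exact hbF.imp (fun h => h.trans (hfirst _)) (fun h => (hlast l).trans h)
    · simp only [Fin.getElem_fin, flood_getElem_add_two, start]
      left
      have : ((k : ℕ) : ℝ) + 1 ≤ (l : ℕ) := by exact_mod_cast (by omega : (k : ℕ) + 1 ≤ l)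
      nlinarith
  · refine flood_forall ?_ ?_ fun k => ?_
    · simpa [flood_getElem_zero, start, hA] using ha
    · simpa [flood_getElem_one, start, hB] using hb
    · simpa only [Fin.getElem_fin, flood_getElem_add_two, start] using hfirst k

variable {σ : ℝ → Option ℕ}

lemma processedReal_nonneg (i : ℕ) (t : ℝ) : 0 ≤ processedReal σ i t := ENNReal.toReal_nonneg

lemma processedReal_flood_add_le (h : IsSchedule (flood A B F hA hB n) σ) {t : ℝ} (ht : 0 ≤ t) :
    processedReal σ 0 t + processedReal σ 1 t ≤ t := by
  have h1 := h.sum_processedReal_sub_le ht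
  have h2 : ∀ i : Fin (flood A B F hA hB n).jobs.length, processedReal σ i 0 = 0 := fun i =>
    h.processedReal_eq_zero i (Job.release_nonneg _)
  simp only [h2, sub_zero] at h1
  rw [sum_flood] at h1
  have h3 : 0 ≤ ∑ k : Fin n, processedReal σ (k + 2) t :=
    Finset.sum_nonneg fun k _ => ENNReal.toReal_nonneg
  simp only at h1
  linarith

/-- Smith's rule from the release date of the copies of `F` on, where the second job is counted
with a weight `u` only. -/
lemma smith_flood_le (h : IsSchedule (flood A B F hA hB n) σ) {x y u : ℝ}
    (hx : x = A.proc - processedReal σ 0 F.release)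
    (hy : y = B.proc - processedReal σ 1 F.release) (hx0 : 0 < x) (hu : 0 ≤ u)
    (huB : u ≤ B.weight) (huy : u = 0 ∨ 0 < y) :
    A.weight * (F.release + x) + u * (F.release + y)
      + (n * F.weight) * (F.release + n * F.proc / 2)
      + min (A.weight * y) (u * x) + min (A.weight * (n * F.proc)) (n * F.weight * x)
      + min (u * (n * F.proc)) (n * F.weight * y) + (B.weight - u) * B.proc
      ≤ totalWeightedCompletionTime (flood A B F hA hB n) σ := by
  have hn0 : (0 : ℝ) ≤ n := n.cast_nonneg
  let v : Fin (flood A B F hA hB n).jobs.length → ℝ := fun i =>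
    if (i : ℕ) = 0 then A.weight else if (i : ℕ) = 1 then u else F.weight
  let z : Fin (flood A B F hA hB n).jobs.length → ℝ := fun i =>
    ((flood A B F hA hB n).jobs[i]).proc - processedReal σ i F.release
  have hz0 : z ⟨0, zero_lt_length_flood⟩ = x := hx.symm
  have hz1 : z ⟨1, one_lt_length_flood⟩ = y := hy.symm
  have hz2 : ∀ k : Fin n, z ⟨k + 2, add_two_lt_length_flood k⟩ = F.proc := by
    intro k
    have hk := h.processedReal_eq_zero ⟨k + 2, add_two_lt_length_flood k⟩ (t := F.release)
      (by simp only [Fin.getElem_fin, flood_getElem_add_two]; exact le_rfl)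
    simp only at hk
    simp only [z, Fin.getElem_fin, flood_getElem_add_two, hk, sub_zero]
  have key := h.smith_le_sum F.release v z ?_ (fun _ => rfl) ?_
  -- The weight of `B` withheld from Smith's bound is still paid for, since `B` cannot complete
  -- before time `B.proc`.
  · have hB1 := mul_le_mul_of_nonneg_left
      (h.release_add_proc_le_completionTime ⟨1, one_lt_length_flood⟩)
      (sub_nonneg.2 huB)
    simp only [Fin.getElem_fin, flood_getElem_one, hB, zero_add] at hB1
    unfold totalWeightedCompletionTime
    simp only [sum_flood, hz0, hz1, hz2] at key ⊢
    simp only [v, Nat.add_eq_zero_iff, Nat.reduceEqDiff, and_false, if_true, if_false,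
      one_ne_zero, OfNat.ofNat_ne_zero, Finset.sum_const, Finset.card_univ, Fintype.card_fin,
      nsmul_eq_mul, min_self, Fin.getElem_fin, flood_getElem_zero, flood_getElem_one,
      flood_getElem_add_two] at key ⊢
    have m1 : min (A.weight * (n * F.proc)) (n * F.weight * x)
        = n * min (A.weight * F.proc) (F.weight * x) := by
      rw [mul_min_of_nonneg _ _ hn0]
      congr 1 <;> ring
    have m2 : min (u * (n * F.proc)) (n * F.weight * y)
        = n * min (u * F.proc) (F.weight * y) := by
      rw [mul_min_of_nonneg _ _ hn0]
      congr 1 <;> ring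
    -- Half of this is the discretisation excess of the flood over a fluid one; the lower bound
    -- drops it.
    have hF : 0 ≤ n * (F.weight * F.proc) :=
      mul_nonneg hn0 (mul_nonneg F.weight_nonneg F.proc_pos.le)
    rw [min_comm (u * x), min_comm (F.weight * x), min_comm (F.weight * y)] at key
    rw [m1, m2]
    linarith
  · refine flood_forall ?_ ?_ fun k => ?_
    · simpa [v] using A.weight_nonneg
    · simpa [v] using hu
    · simpa [v] using F.weight_nonneg
  · refine flood_forall ?_ ?_ fun k => ?_
    · exact Or.inr (hz0.symm ▸ hx0)
    · rw [hz1]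
      simpa [v] using huy
    · exact Or.inr ((hz2 k).symm ▸ F.proc_pos)

end Flood

/-! ### The adversary and its numerical verification -/

lemma totalWeightedCompletionTime_schedule_lt {A : OnlineAlgorithm} {c U : ℝ} {I : JobInstance}
    (hA : A.IsCompetitive c) (hc : c < 1.1038) (hU : 0 < U) (hI : optimalCost I ≤ U) :
    totalWeightedCompletionTime I (A.schedule I) < 1.1038 * U := by
  have h := hA I
  have h0 : 0 ≤ optimalCost I :=
    Real.sInf_nonneg (by rintro _ ⟨τ, hτ, rfl⟩; exact hτ.totalWeightedCompletionTime_nonneg)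
  -- A negative `c` is not excluded in advance; then `c * optimalCost I ≤ 0`, which is below the
  -- target.
  rcases le_total 0 c with h1 | h1 <;> nlinarith

/-- The schedules on two floods that start with the same two jobs agree until one of the floods
arrives. -/
lemma processed_schedule_flood_congr (S : OnlineAlgorithm) {A B F G : Job}
    (hA : A.release = 0) (hB : B.release = 0) (m n i : ℕ) {t : ℝ}
    (hF : t ≤ F.release) (hG : t ≤ G.release) :
    processedReal (S.schedule (flood A B F hA hB m)) i t
      = processedReal (S.schedule (flood A B G hA hB n)) i t := by
  unfold processedReal processed
  congr 1
  apply measure_congr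
  -- At time `t` itself a flood may already be visible, but a single instant has measure zero.
  have hne : ∀ᵐ s : ℝ, s ≠ t := by simp [ae_iff]
  filter_upwards [hne] with s hs
  refine propext (and_congr_right fun hst => ?_)
  have hlt := lt_of_le_of_ne hst hs
  unfold OnlineAlgorithm.schedule
  rw [known_flood_of_lt (hlt.trans_le hF), known_flood_of_lt (hlt.trans_le hG)]

/-- Here `x` and `y` are the remainders of the long and the short job at time 1. The nearly tight
case is `x = 4/3`, `y = 1`, where only the long job has run. -/
lemma early_flood_cost {x y : ℝ} (hxy : 7 / 3 ≤ x + y) (hy : 0.49 ≤ y)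
    (hy1 : y ≤ 1) :
    1.1038 * (7 / 3 * (21 / 5 + 7 / 3) + 1 + (28 / 5 + 28 / 5 * (8 / 5) + 1 / 100000))
      ≤ 7 / 3 * (1 + x) + (1 + y) + 28 / 5 * (1 + 8 / 5) + min (7 / 3 * y) x
        + min (7 / 3 * (16 / 5)) (28 / 5 * x) + min (16 / 5) (28 / 5 * y) := by
  rcases min_cases (7 / 3 * y) x with ⟨h1, _⟩ | ⟨h1, _⟩ <;>
  rcases min_cases (7 / 3 * (16 / 5) : ℝ) (28 / 5 * x) with ⟨h2, _⟩ | ⟨h2, _⟩ <;>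
  rcases min_cases (16 / 5 : ℝ) (28 / 5 * y) with ⟨h3, _⟩ | ⟨h3, _⟩ <;>
  rw [h1, h2, h3] <;> linarith

lemma late_flood_cost {x y : ℝ} (hxy : 1 ≤ x + y) (hy0 : 0 ≤ y) (hy : y ≤ 0.49) :
    1.1038 * (7 / 3 * (7 / 3) + (7 / 3 + 11 / 4 + 1)
        + (77 / 12 * (7 / 3) + 77 / 12 * (11 / 8) + 1 / 100000))
      ≤ 7 / 3 * (7 / 3 + x) + (7 / 3 + y) + 77 / 12 * (7 / 3 + 11 / 8) + min (7 / 3 * y) x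
        + min (7 / 3 * (11 / 4)) (77 / 12 * x) + min (11 / 4) (77 / 12 * y) := by
  rcases min_cases (7 / 3 * y) x with ⟨h1, _⟩ | ⟨h1, _⟩ <;>
  rcases min_cases (7 / 3 * (11 / 4) : ℝ) (77 / 12 * x) with ⟨h2, _⟩ | ⟨h2, _⟩ <;>
  rcases min_cases (11 / 4 : ℝ) (77 / 12 * y) with ⟨h3, _⟩ | ⟨h3, _⟩ <;>
  rw [h1, h2, h3] <;> linarith

/-- This case is nearly tight at `x = 1`: the short job ran first, and the final 1 is the least it
can cost. An unfinished short job costs more, as it completes only after the flood's release. -/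
lemma late_flood_cost_of_finished {x : ℝ} (hx : 1 ≤ x) :
    1.1038 * (7 / 3 * (7 / 3) + (7 / 3 + 11 / 4 + 1)
        + (77 / 12 * (7 / 3) + 77 / 12 * (11 / 8) + 1 / 100000))
      ≤ 7 / 3 * (7 / 3 + x) + 77 / 12 * (7 / 3 + 11 / 8)
        + min (7 / 3 * (11 / 4)) (77 / 12 * x) + 1 := by
  rcases min_cases (7 / 3 * (11 / 4) : ℝ) (77 / 12 * x) with ⟨h2, _⟩ | ⟨h2, _⟩ <;>
  rw [h2] <;> linarith

/-- The adversary releases two jobs of unit density at time `0`. If the short job has not been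
half processed by time `1`, then a flood of tiny jobs arrives at time `1`, otherwise at the time
at which the long job could have been completed. -/
lemma le_of_isCompetitive {S : OnlineAlgorithm} {c : ℝ} (hS : S.IsCompetitive c) :
    1.1038 ≤ c := by
  by_contra! hc
  obtain ⟨n, hn⟩ := exists_nat_ge (1000000 : ℝ)
  have hn0 : (0 : ℝ) < n := by linarith
  let A : Job := ⟨0, 7 / 3, 7 / 3, le_rfl, by norm_num, by norm_num⟩
  let B : Job := ⟨0, 1, 1, le_rfl, one_pos, zero_le_one⟩
  -- Each flood's density equals weight over remainder of the long job in the corresponding nearly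
  -- tight case: 7/4 = (7/3)/(4/3) for `F`, and 7/3 = (7/3)/1 for `G`.
  let F : Job := ⟨1, 16 / 5 / n, 28 / 5 / n, zero_le_one, by positivity, by positivity⟩
  let G : Job := ⟨7 / 3, 11 / 4 / n, 77 / 12 / n, by norm_num, by positivity, by positivity⟩
  have hFp : n * F.proc = 16 / 5 := mul_div_cancel₀ _ hn0.ne'
  have hFw : n * F.weight = 28 / 5 := mul_div_cancel₀ _ hn0.ne'
  have hGp : n * G.proc = 11 / 4 := mul_div_cancel₀ _ hn0.ne'
  have hGw : n * G.weight = 77 / 12 := mul_div_cancel₀ _ hn0.ne'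
  -- The slack 1/100000 absorbs the excess over a fluid flood, which is of order 1/n.
  have hFn : F.weight * F.proc * n * (n + 1) / 2 ≤ 28 / 5 * (8 / 5) + 1 / 100000 := by
    have h1 : F.proc ≤ 16 / 5 / 1000000 := div_le_div_of_nonneg_left (by norm_num) (by norm_num) hn
    have h2 : F.weight * F.proc * n * (n + 1) / 2
        = (n * F.weight) * (n * F.proc) / 2 + (n * F.weight) * F.proc / 2 := by ring
    rw [h2, hFp, hFw]
    linarith
  have hGn : G.weight * G.proc * n * (n + 1) / 2 ≤ 77 / 12 * (11 / 8) + 1 / 100000 := by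
    have h1 : G.proc ≤ 11 / 4 / 1000000 := div_le_div_of_nonneg_left (by norm_num) (by norm_num) hn
    have h2 : G.weight * G.proc * n * (n + 1) / 2
        = (n * G.weight) * (n * G.proc) / 2 + (n * G.weight) * G.proc / 2 := by ring
    rw [h2, hGp, hGw]
    linarith
  let I := flood A B F rfl rfl n
  let J := flood A B G rfl rfl n
  have hI : IsSchedule I (S.schedule I) := S.feasible I
  have hJ : IsSchedule J (S.schedule J) := S.feasible J
  have hIJ : processedReal (S.schedule I) 1 1 = processedReal (S.schedule J) 1 1 :=
    processed_schedule_flood_congr S _ _ n n 1 (F := F) (G := G) le_rfl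
      (show (1 : ℝ) ≤ 7 / 3 by norm_num)
  rcases le_total (processedReal (S.schedule I) 1 1) 0.51 with hy | hy
  -- Offline order: short job, flood, long job; the flood ends at 1 + 16/5 = 21/5.
  · have hopt := optimalCost_flood_le (A := A) (B := B) (F := F) (hA := rfl) (hB := rfl) (n := n)
      (a := 21 / 5) (b := 0) (by norm_num) le_rfl (Or.inr (by norm_num [B]))
      (Or.inr (by rw [hFp]; norm_num [F])) (Or.inl (by norm_num [B, F]))
    rw [hFw] at hopt
    have hsum := processedReal_flood_add_le hI zero_le_one
    have hx0 := processedReal_nonneg (σ := S.schedule I) 0 1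
    have hy0 := processedReal_nonneg (σ := S.schedule I) 1 1
    have halg := smith_flood_le hI (u := 1) rfl rfl
      (show 0 < 7 / 3 - processedReal (S.schedule I) 0 1 by linarith) zero_le_one le_rfl
      (Or.inr (show 0 < 1 - processedReal (S.schedule I) 1 1 by linarith))
    rw [hFp, hFw] at halg
    have hnum := early_flood_cost (x := 7 / 3 - processedReal (S.schedule I) 0 1)
      (y := 1 - processedReal (S.schedule I) 1 1)
      (by linarith) (by linarith) (by linarith)
    have hlt := totalWeightedCompletionTime_schedule_lt hS hc
      (U := 7 / 3 * (21 / 5 + 7 / 3) + 1 + (28 / 5 + 28 / 5 * (8 / 5) + 1 / 100000))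
      (by norm_num) (hopt.trans (by simp only [A, B, F] at hFn ⊢; linarith))
    simp only [A, B, F, one_mul, sub_self, zero_mul, add_zero] at halg
    refine absurd (halg.trans_lt hlt) (not_lt.2 (hnum.trans (le_of_eq ?_)))
    norm_num
  · rw [hIJ] at hy
    -- Offline order: long job, flood, short job.
    have hopt := optimalCost_flood_le (A := A) (B := B) (F := G) (hA := rfl) (hB := rfl) (n := n)
      (a := 0) (b := 7 / 3 + 11 / 4) le_rfl (by norm_num) (Or.inl (by norm_num [A]))
      (Or.inl (by norm_num [A, G])) (Or.inr (by rw [hGp]))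
    rw [hGw] at hopt
    have hlt := totalWeightedCompletionTime_schedule_lt hS hc
      (U := 7 / 3 * (7 / 3) + (7 / 3 + 11 / 4 + 1)
        + (77 / 12 * (7 / 3) + 77 / 12 * (11 / 8) + 1 / 100000))
      (by norm_num) (hopt.trans (by simp only [A, B, G] at hGn ⊢; linarith))
    have hsum := processedReal_flood_add_le hJ (show (0 : ℝ) ≤ 7 / 3 by norm_num)
    have hmono := hJ.processedReal_mono ⟨1, one_lt_length_flood⟩
      (show (1 : ℝ) ≤ 7 / 3 by norm_num)
    have hle : processedReal (S.schedule J) 1 (7 / 3) ≤ 1 :=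
      hJ.processedReal_le ⟨1, one_lt_length_flood⟩ (7 / 3)
    simp only at hmono
    have hx : 0 < 7 / 3 - processedReal (S.schedule J) 0 (7 / 3) := by linarith
    -- If the short job is already finished, its completion may precede the flood, so Smith's bound
    -- must give it weight 0.
    rcases hle.eq_or_lt with hfin | hunf
    · have halg := smith_flood_le hJ (u := 0) rfl rfl hx le_rfl zero_le_one (Or.inl rfl)
      rw [hGp, hGw] at halg
      have hnum := late_flood_cost_of_finished
        (x := 7 / 3 - processedReal (S.schedule J) 0 (7 / 3)) (by linarith)
      simp only [A, B, G, hfin] at halg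
      refine absurd (halg.trans_lt hlt) (not_lt.2 (hnum.trans (le_of_eq ?_)))
      norm_num
    · have halg := smith_flood_le hJ (u := 1) rfl rfl hx zero_le_one le_rfl
        (Or.inr (show 0 < 1 - processedReal (S.schedule J) 1 (7 / 3) by linarith))
      rw [hGp, hGw] at halg
      have hnum := late_flood_cost (x := 7 / 3 - processedReal (S.schedule J) 0 (7 / 3))
        (y := 1 - processedReal (S.schedule J) 1 (7 / 3))
        (by linarith) (by linarith) (by linarith)
      simp only [A, B, G, one_mul, sub_self, zero_mul, add_zero] at halg
      refine absurd (halg.trans_lt hlt) (not_lt.2 (hnum.trans (le_of_eq ?_)))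
      norm_num

theorem theorem2 (A : OnlineAlgorithm) : ((1.1038 : ℝ) : EReal) ≤ A.competitiveRatio :=
  le_iInf₂ fun _ hc => EReal.coe_le_coe_iff.2 (le_of_isCompetitive hc)
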